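/- Let $S_\infty$ be the group of permutations of $\{1,2,3,\dots\}$ with finite support, $s_i$ the transposition of $i$ and $i+1$, and $\ell(w)$ the minimum length of a word $s_{a_1}\cdots s_{a_r}=w$. Let $*$ be the Demazure ($0$-Hecke) product, so that $s_i*v=s_iv$ if $\ell(s_iv)>\ell(v)$ and $s_i*v=v$ otherwise. For a finite sequence $\mathbf a=(a_1,\dots,a_r)$ of positive integers put $\partial(\mathbf a)=s_{a_1}*\cdots*s_{a_r}$. An (ordinary) pipe dream is a finite set $P$ of positions $(i,j)$ with $i,j\ge 1$; its word lists the letters $i+j-1$ for $(i,j)\in P$, reading each row from right to left, from the top row (row $1$) downwards, and $P$ belongs to $\mathrm{PD}^+(w)$ if $\partial$ of its word is $w$. In $\mathbb Z[\beta][x_1,x_2,\dots]$ define $$\mathfrak G^{(\beta)}_w(x)=\sum_{P\in \mathrm{PD}^+(w)}\beta^{|P|-\ell(w)}\prod_{(i,j)\in P}x_i,\qquad e_k^{(\beta)}(x_1,\dots,x_m)=\sum_{\substack{J\subseteq I\subseteq\{1,\dots,m\}\\ |J|=k}}\beta^{|I|-k}\prod_{i\in I}x_i .$$ For $m\ge 1$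 and $w\in S_\infty$ let $w\ominus_m1\in S_\infty$ be the permutation with $(w\ominus_m1)(i)=w(i)+1$ for $1\le i\le m$, $(w\ominus_m1)(m+1)=1$, and $(w\ominus_m1)(i)=w(i-1)+1$ for $i\ge m+2$. **Proposition.** Let $m\ge1$, $k\ge0$, and let $w\in S_\infty$ satisfy $\mathrm{Des}(w)=\{i: w(i)>w(i+1)\}\subseteq\{1,\dots,m\}$. Then $$e_k^{(\beta)}(x_1,\dots,x_m)\,\mathfrak G^{(\beta)}_w(x)=\sum_{(v,\mathbf a)}\beta^{\ell(v)-\ell(w)-k}\,\mathfrak G^{(\beta)}_v(x),$$ where the sum runs over all pairs of $v\in S_\infty$ and $\mathbf a=(a_1<\cdots<a_{m-k})$ (positive integers) with $w\ominus_m1=\partial(\mathbf a)*v$; there are no such pairs if $k>m$. All the sets $\mathrm{PD}^+(u)$, $u\in S_\infty$, and the index set of the sum are finite, and $\ell(v)\ge\ell(w)+k$ for every pair in the sum. -/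

import Mathlib

/-!
Conventions.  The set `{1, 2, 3, …}` is modelled by `ℕ` through `i ↦ i - 1`: positions and values of
permutations, indices of simple transpositions, rows and columns of pipe dreams, and indices of the
variables all start at `0` here.  So `X i` is the variable `x_{i+1}`, `simpleRefl i` is `s_{i+1}`,
and `{i | i < m}` is `[m] = {1, …, m}`.
-/

namespace PipeDream

open MvPolynomial

/-- The group `S_∞` of permutations of `{1, 2, …}` with finite support. -/
def SInf : Subgroup (Equiv.Perm ℕ) where
  carrier := {w | {i | w i ≠ i}.Finite}
  one_mem' := by simp
  mul_mem' := by
    intro a b ha hb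
    refine (Set.Finite.union ha hb).subset ?_
    intro i hi
    by_contra h
    simp only [Set.mem_union, Set.mem_ofPred_eq, not_or, not_not] at h
    exact hi (by rw [Equiv.Perm.mul_apply, h.2, h.1])
  inv_mem' := by
    intro a ha
    refine Set.Finite.subset ha ?_
    intro i hi h
    exact hi (by rw [Equiv.Perm.inv_eq_iff_eq]; exact h.symm)

/-- The simple transposition exchanging a letter and its successor. -/
def simpleRefl (i : ℕ) : SInf :=
  ⟨Equiv.swap i (i + 1), by
    refine (Set.toFinite ({i, i + 1} : Set ℕ)).subset ?_
    intro j hj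
    by_contra h
    simp only [Set.mem_insert_iff, Set.mem_singleton_iff, not_or] at h
    exact hj (Equiv.swap_apply_of_ne_of_ne h.1 h.2)⟩

/-- `l` is a word for `w`: `w = s_{a_1} ⋯ s_{a_r}` where `l = (a_1, …, a_r)`. -/
def IsWord (l : List ℕ) (w : SInf) : Prop :=
  (l.map simpleRefl).prod = w

/-- The length `ℓ(w)`: the minimum length of a word for `w`. -/
noncomputable def permLength (w : SInf) : ℕ :=
  sInf {r | ∃ l : List ℕ, l.length = r ∧ IsWord l w}

/-- The descent set of `w`. -/
def descents (w : SInf) : Set ℕ :=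
  {i | (w : Equiv.Perm ℕ) (i + 1) < (w : Equiv.Perm ℕ) i}

/-- The product `s_i * v` in the Demazure (`0`-Hecke) algebra, in terms of its basis `S_∞`:
it is `s_i v` if this is longer than `v`, and `v` otherwise. -/
noncomputable def demazureSimple (i : ℕ) (v : SInf) : SInf :=
  if permLength v < permLength (simpleRefl i * v) then simpleRefl i * v else v

/-- The product `∂(a) * v = e_{a_1} ⋯ e_{a_r} * v` in the Demazure algebra, for a list of letters
`a = (a_1, …, a_r)`, which need not be a reduced word. -/
noncomputable def demazureMul (a : List ℕ) (v : SInf) : SInf :=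
  a.foldr demazureSimple v

/-- The element `∂(a) = e_{a_1} ⋯ e_{a_r}` of the Demazure algebra, as an element of `S_∞`. -/
noncomputable def demazure (a : List ℕ) : SInf :=
  demazureMul a 1

/-- The word of an ordinary pipe dream `P`, a finite set of positions (row, column): the letters
`row + column` (this is `i + j - 1` when counting from `1`) are read from right to left in each
row, starting with the top row and moving down. -/
def word (P : Finset (ℕ × ℕ)) : List ℕ :=
  ((P.image fun p => toLex (p.1, OrderDual.toDual p.2)).sort).map
    fun q => (ofLex q).1 + OrderDual.ofDual (ofLex q).2

/-- The set `PD⁺(w)` of ordinary pipe dreams (reduced or not) with permutation `w`. -/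
def pipeDreams (w : SInf) : Set (Finset (ℕ × ℕ)) :=
  {P | demazure (word P) = w}

/-- The ring `ℤ[β][x_1, x_2, …]`. -/
abbrev BetaPoly : Type := MvPolynomial ℕ (Polynomial ℤ)

/-- The parameter `β`. -/
noncomputable def beta : BetaPoly := C Polynomial.X

/-- The weight of a pipe dream `P` with permutation `w`. -/
noncomputable def weight (w : SInf) (P : Finset (ℕ × ℕ)) : BetaPoly :=
  beta ^ (P.card - permLength w) * ∏ p ∈ P, X p.1

/-- The `β`-Grothendieck polynomial of `w`. -/
noncomputable def grothendieck (w : SInf) : BetaPoly :=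
  ∑ᶠ P ∈ pipeDreams w, weight w P

/-- The deformed elementary symmetric polynomial
`e_k^{(β)}(x_1, …, x_m) = ∑_{J ⊆ I ⊆ [m], |J| = k} β^{|I| - k} x_I`. -/
noncomputable def betaElem (m k : ℕ) : BetaPoly :=
  ∑ I ∈ (Finset.range m).powerset, ∑ _J ∈ I.powersetCard k,
    beta ^ (I.card - k) * ∏ i ∈ I, X i

/-- The function underlying `w ⊖_m 1`. -/
def ominusFun (m : ℕ) (w : Equiv.Perm ℕ) (i : ℕ) : ℕ :=
  if i < m then w i + 1 else if i = m then 0 else w (i - 1) + 1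

/-- The permutation `w ⊖_m 1`. -/
def ominus (m : ℕ) (w : SInf) : SInf :=
  ⟨{ toFun := ominusFun m w
     invFun := fun j =>
      if j = 0 then m
      else if (w : Equiv.Perm ℕ).symm (j - 1) < m then (w : Equiv.Perm ℕ).symm (j - 1)
      else (w : Equiv.Perm ℕ).symm (j - 1) + 1
     left_inv := by
      intro i
      unfold ominusFun
      rcases lt_trichotomy i m with h | h | h
      · simp [h]
      · simp [h]
      · have h1 : ¬ i < m := by omega
        have h2 : i ≠ m := by omega
        have h3 : ¬ i - 1 < m := by omega
        simp [h1, h2, h3]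
        omega
     right_inv := by
      intro j
      unfold ominusFun
      by_cases h0 : j = 0
      · simp [h0]
      · by_cases h : (w : Equiv.Perm ℕ).symm (j - 1) < m
        · simp [h0, h]
          omega
        · have h1 : ¬ (w : Equiv.Perm ℕ).symm (j - 1) + 1 < m := by omega
          have h2 : (w : Equiv.Perm ℕ).symm (j - 1) + 1 ≠ m := by omega
          simp [h0, h, h1, h2]
          omega }, by
    refine ((Set.finite_le_nat m).union (Set.Finite.image (· + 1) w.2)).subset ?_
    intro i hi
    by_contra h
    simp only [Set.mem_union, Set.mem_ofPred_eq, Set.mem_image, not_or, not_exists, not_and] at h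
    have h1 : ¬ i < m := by omega
    have h2 : i ≠ m := by omega
    have h3 : (w : Equiv.Perm ℕ) (i - 1) = i - 1 := by
      by_contra h4
      exact h.2 (i - 1) h4 (by omega)
    apply hi
    change ominusFun m w i = i
    unfold ominusFun
    rw [if_neg h1, if_neg h2, h3]
    omega⟩

/-- The index set of the Pieri rule: the pairs of `v` and `a_1 < ⋯ < a_{m-k}` (given as a finite
set `a` with `m - k` elements; there are none if `k > m`) with `w ⊖_m 1 = ∂(a) * v`. -/
def pieriIndex (m k : ℕ) (w : SInf) : Set (SInf × Finset ℕ) :=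
  {p | p.2.card + k = m ∧ ominus m w = demazureMul p.2.sort p.1}

end PipeDream

/-!
The `0`-Hecke algebra of `S_∞`, with `e_i ^ 2 = β e_i`, acts on the free module with basis `S_∞` by
operators `heckeGen β i`, and a word `a` sends `[v]` to `β ^ (|a| + ℓ(v) - ℓ(∂(a) * v)) [∂(a) * v]`
(`heckeWord_single`). Put `h_i(x) = 1 + x e_i`. Reading pipe dreams row by row, the coefficient of
`[v]` in `G [1]`, where `G = ∏_r h_{n-1}(x_r) ⋯ h_r(x_r)`, is the `β`-Grothendieck polynomial of `v`
for `n` large (`prod_stairRow_apply`). Hence the right-hand sides for all `k` at once, marked by powers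
`y ^ (m - k)`, form the coefficient of `[w ⊖_m 1]` in `h_0(y) ⋯ h_{n-1}(y) G [1]`
(`ascProd_mul_stair_apply`).

By the Yang–Baxter equation, the increasing product can be moved through the rows of `G`; it
disappears at the end, and its only effect is to replace the last factor `h_r(x_r)` of each row by
`h_r(x_r ⊕ y)`, where `x ⊕ y = x + y + β x y` (`HeckeRelations.ascProd_mul_stair`). The permutation
`w ⊖_m 1` takes the value `0` at position `m`, and all its descents are less than `m`. The first
property forces each of the rows `0, …, m - 1` to use its last letter (`prod_markedRow_sub_mem`); the
second forces the letters `≥ m` not to be used (`prod_rows_apply`). Moving the letters `0, …, m - 1`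
to the right produces `e_0 ⋯ e_{m-1} [1] = [1 ⊖_m 1]`, and `e_{i+1} [v ⊖_m 1]` is the image of `e_i [v]`
under `v ↦ v ⊖_m 1`, so that the remaining factors give the Grothendieck polynomial of `w`
(`prod_markedRow_apply_ominus`). The coefficient is therefore `∏_{r < m} (x_r ⊕ y)` times that
polynomial, and expanding the product in powers of `y` gives the deformed elementary symmetric
polynomials (`prod_formalSum`).
-/

namespace PipeDream

open MvPolynomial

/-! ### Lengths and inversions -/

/-- The position at which `v` takes the value `i`, that is, `v⁻¹(i)`. -/
def pos (v : SInf) (i : ℕ) : ℕ := (v : Equiv.Perm ℕ).symm i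

theorem pos_injective (v : SInf) : Function.Injective (pos v) :=
  (v : Equiv.Perm ℕ).symm.injective

theorem apply_pos (v : SInf) (i : ℕ) : (v : Equiv.Perm ℕ) (pos v i) = i :=
  (v : Equiv.Perm ℕ).apply_symm_apply i

theorem pos_apply (v : SInf) (i : ℕ) : pos v ((v : Equiv.Perm ℕ) i) = i :=
  (v : Equiv.Perm ℕ).symm_apply_apply i

theorem ext_pos {v w : SInf} (h : ∀ i, pos v i = pos w i) : v = w := by
  apply Subtype.ext
  have : (v : Equiv.Perm ℕ).symm = (w : Equiv.Perm ℕ).symm := Equiv.ext h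
  rw [← Equiv.symm_symm (v : Equiv.Perm ℕ), this, Equiv.symm_symm]

theorem pos_one (i : ℕ) : pos 1 i = i := rfl

theorem pos_simpleRefl_mul (i : ℕ) (v : SInf) (j : ℕ) :
    pos (simpleRefl i * v) j = pos v (Equiv.swap i (i + 1) j) := rfl

theorem simpleRefl_mul_self (i : ℕ) (v : SInf) : simpleRefl i * (simpleRefl i * v) = v :=
  ext_pos fun j => by rw [pos_simpleRefl_mul, pos_simpleRefl_mul, Equiv.swap_apply_self]

/-- `v` fixes all values `≥ n`. -/
def FixesFrom (n : ℕ) (v : SInf) : Prop := ∀ i, n ≤ i → (v : Equiv.Perm ℕ) i = i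

theorem FixesFrom.mono {n n' : ℕ} {v : SInf} (h : FixesFrom n v) (hn : n ≤ n') :
    FixesFrom n' v := fun i hi => h i (hn.trans hi)

theorem FixesFrom.pos_eq {n : ℕ} {v : SInf} (h : FixesFrom n v) {i : ℕ} (hi : n ≤ i) :
    pos v i = i := by
  conv_lhs => rw [← h i hi]
  exact pos_apply v i

theorem FixesFrom.pos_lt {n : ℕ} {v : SInf} (h : FixesFrom n v) {i : ℕ} (hi : i < n) :
    pos v i < n := by
  by_contra hc
  have := h _ (not_lt.mp hc)
  rw [apply_pos] at this
  omega

theorem exists_fixesFrom (v : SInf) : ∃ n, FixesFrom n v := by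
  obtain ⟨n, hn⟩ := v.2.bddAbove
  refine ⟨n + 1, fun i hi => ?_⟩
  by_contra hc
  have : i ≤ n := hn hc
  omega

/-- The inversions of `v`, recorded as pairs of values. -/
def inversions (v : SInf) : Set (ℕ × ℕ) := {p | p.1 < p.2 ∧ pos v p.2 < pos v p.1}

theorem finite_inversions (v : SInf) : (inversions v).Finite := by
  obtain ⟨n, hn⟩ := exists_fixesFrom v
  refine ((Set.finite_lt_nat n).prod (Set.finite_lt_nat n)).subset ?_
  rintro ⟨a, b⟩ ⟨h1, h2⟩
  simp only at h1 h2
  have hb : b < n := by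
    by_contra hb
    rw [hn.pos_eq (not_lt.mp hb)] at h2
    rcases lt_or_ge a n with ha | ha
    · have := hn.pos_lt ha
      omega
    · rw [hn.pos_eq ha] at h2
      omega
  exact ⟨show a < n by omega, hb⟩

theorem swap_succ_lt {i a b : ℕ} (hab : a < b) (h : ¬ (a = i ∧ b = i + 1)) :
    Equiv.swap i (i + 1) a < Equiv.swap i (i + 1) b := by
  rw [Equiv.swap_apply_def, Equiv.swap_apply_def]
  split_ifs <;> omega

theorem ncard_inversions_simpleRefl_mul {i : ℕ} {v : SInf} (h : pos v i < pos v (i + 1)) :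
    (inversions (simpleRefl i * v)).ncard = (inversions v).ncard + 1 := by
  have himg : inversions (simpleRefl i * v) = insert (i, i + 1)
      (Prod.map (Equiv.swap i (i + 1)) (Equiv.swap i (i + 1)) '' inversions v) := by
    ext ⟨a, b⟩
    simp only [Set.mem_insert_iff, Set.mem_image, Prod.exists, Prod.map_apply, Prod.mk.injEq]
    constructor
    · rintro ⟨h1, h2⟩
      simp only [pos_simpleRefl_mul] at h1 h2
      by_cases hc : a = i ∧ b = i + 1
      · exact Or.inl hc
      · exact Or.inr ⟨_, _, ⟨swap_succ_lt h1 hc, h2⟩, Equiv.swap_apply_self _ _ _,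
          Equiv.swap_apply_self _ _ _⟩
    · rintro (⟨rfl, rfl⟩ | ⟨a, b, ⟨h1, h2⟩, rfl, rfl⟩)
      · refine ⟨Nat.lt_succ_self _, ?_⟩
        simpa [pos_simpleRefl_mul] using h
      · simp only at h1 h2
        refine ⟨swap_succ_lt h1 ?_, ?_⟩
        · rintro ⟨rfl, rfl⟩
          omega
        · simpa [pos_simpleRefl_mul] using h2
  rw [himg, Set.ncard_insert_of_notMem _ ((finite_inversions v).image _),
    Set.ncard_image_of_injective]
  · exact (Equiv.injective _).prodMap (Equiv.injective _)
  · rintro ⟨⟨a, b⟩, ⟨h1, -⟩, h2⟩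
    simp only [Prod.map_apply, Prod.mk.injEq] at h1 h2
    have ha := congrArg (Equiv.swap i (i + 1)) h2.1
    have hb := congrArg (Equiv.swap i (i + 1)) h2.2
    simp only [Equiv.swap_apply_self, Equiv.swap_apply_left, Equiv.swap_apply_right] at ha hb
    omega

theorem ncard_inversions_simpleRefl_mul_of_lt {i : ℕ} {v : SInf} (h : pos v (i + 1) < pos v i) :
    (inversions (simpleRefl i * v)).ncard + 1 = (inversions v).ncard := by
  have h' : pos (simpleRefl i * v) i < pos (simpleRefl i * v) (i + 1) := by
    simpa [pos_simpleRefl_mul] using h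
  rw [← ncard_inversions_simpleRefl_mul h', simpleRefl_mul_self]

theorem pos_lt_or_gt (v : SInf) (i : ℕ) :
    pos v i < pos v (i + 1) ∨ pos v (i + 1) < pos v i :=
  lt_or_gt_of_ne fun h => by simpa using pos_injective v h

/-- A bijection of `ℕ` that is increasing is the identity, so `v ≠ 1` has a left descent. -/
theorem exists_pos_succ_lt {v : SInf} (hv : v ≠ 1) : ∃ i, pos v (i + 1) < pos v i := by
  by_contra! hc
  have hmono : StrictMono (pos v) := strictMono_nat_of_lt_succ fun i =>
    (pos_lt_or_gt v i).resolve_right (not_lt.mpr (hc i))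
  refine hv (ext_pos fun i => ?_)
  rw [pos_one]
  have hsurj : Function.Surjective (pos v) := (v : Equiv.Perm ℕ).symm.surjective
  have := Subsingleton.elim (hmono.orderIsoOfSurjective _ hsurj) (OrderIso.refl ℕ)
  exact congrArg (fun f : ℕ ≃o ℕ => f i) this

theorem inversions_one : inversions 1 = ∅ := by
  ext ⟨a, b⟩
  simp only [inversions, Set.mem_ofPred_eq, pos_one, Set.mem_empty_iff_false, iff_false]
  omega

/-- Induction along left weak order: every `v ≠ 1` is `s_i u` for some shorter `u`. -/
theorem leftWeak_induction {p : SInf → Prop} (one : p 1)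
    (mul : ∀ i v, pos v i < pos v (i + 1) → p v → p (simpleRefl i * v)) (v : SInf) : p v := by
  induction hn : (inversions v).ncard generalizing v with
  | zero =>
    by_cases hv : v = 1
    · exact hv ▸ one
    obtain ⟨i, hi⟩ := exists_pos_succ_lt hv
    have := ncard_inversions_simpleRefl_mul_of_lt hi
    omega
  | succ n ih =>
    by_cases hv : v = 1
    · exact hv ▸ one
    obtain ⟨i, hi⟩ := exists_pos_succ_lt hv
    have := ncard_inversions_simpleRefl_mul_of_lt hi
    rw [← simpleRefl_mul_self i v]
    refine mul i _ ?_ (ih _ (by omega))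
    simpa [pos_simpleRefl_mul] using hi

theorem exists_word (v : SInf) : ∃ l : List ℕ, l.length = (inversions v).ncard ∧ IsWord l v := by
  induction v using leftWeak_induction with
  | one => exact ⟨[], by simp [inversions_one], rfl⟩
  | mul i v hi ih =>
    obtain ⟨l, hl, rfl⟩ := ih
    exact ⟨i :: l, by rw [ncard_inversions_simpleRefl_mul hi, List.length_cons, hl], rfl⟩

theorem ncard_inversions_le_of_isWord {l : List ℕ} {v : SInf} (h : IsWord l v) :
    (inversions v).ncard ≤ l.length := by
  induction l generalizing v with
  | nil =>
    obtain rfl : (1 : SInf) = v := h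
    simp [inversions_one]
  | cons i l ih =>
    have h' : simpleRefl i * (l.map simpleRefl).prod = v := h
    have hl := ih (v := (l.map simpleRefl).prod) rfl
    rw [← h', List.length_cons]
    rcases pos_lt_or_gt (l.map simpleRefl).prod i with hi | hi
    · rw [ncard_inversions_simpleRefl_mul hi]
      omega
    · have := ncard_inversions_simpleRefl_mul_of_lt hi
      omega

theorem permLength_eq_ncard_inversions (v : SInf) : permLength v = (inversions v).ncard := by
  obtain ⟨l, hl, hw⟩ := exists_word v
  refine le_antisymm (Nat.sInf_le ⟨l, hl, hw⟩) (le_csInf ⟨_, l, hl, hw⟩ ?_)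
  rintro _ ⟨l', rfl, hw'⟩
  exact ncard_inversions_le_of_isWord hw'

theorem permLength_simpleRefl_mul {i : ℕ} {v : SInf} (h : pos v i < pos v (i + 1)) :
    permLength (simpleRefl i * v) = permLength v + 1 := by
  simp only [permLength_eq_ncard_inversions, ncard_inversions_simpleRefl_mul h]

theorem permLength_one : permLength 1 = 0 :=
  Nat.le_zero.mp (Nat.sInf_le ⟨[], rfl, rfl⟩)

/-! ### The Demazure product -/

theorem demazureSimple_of_lt {i : ℕ} {v : SInf} (h : pos v i < pos v (i + 1)) :
    demazureSimple i v = simpleRefl i * v := by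
  rw [demazureSimple, if_pos (by rw [permLength_simpleRefl_mul h]; omega)]

theorem demazureSimple_of_gt {i : ℕ} {v : SInf} (h : pos v (i + 1) < pos v i) :
    demazureSimple i v = v := by
  have := ncard_inversions_simpleRefl_mul_of_lt h
  rw [demazureSimple, if_neg (by simp only [permLength_eq_ncard_inversions]; omega)]

/-- In terms of positions, multiplying by `s_i` in the Demazure product sorts the positions of the
values `i` and `i + 1` into decreasing order. -/
theorem pos_demazureSimple (i : ℕ) (v : SInf) (j : ℕ) :
    pos (demazureSimple i v) j =
      if j = i then max (pos v i) (pos v (i + 1))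
      else if j = i + 1 then min (pos v i) (pos v (i + 1)) else pos v j := by
  rcases pos_lt_or_gt v i with h | h
  · rw [demazureSimple_of_lt h, pos_simpleRefl_mul, Equiv.swap_apply_def, max_eq_right h.le,
      min_eq_left h.le]
    split_ifs <;> rfl
  · rw [demazureSimple_of_gt h, max_eq_left h.le, min_eq_right h.le]
    split_ifs with h1 h2
    · rw [h1]
    · rw [h2]
    · rfl

theorem demazureSimple_idem (i : ℕ) (v : SInf) :
    demazureSimple i (demazureSimple i v) = demazureSimple i v := by
  apply demazureSimple_of_gt
  have := pos_lt_or_gt v i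
  simp only [pos_demazureSimple]
  simp
  omega

theorem demazureSimple_comm {i j : ℕ} (h : i + 2 ≤ j) (v : SInf) :
    demazureSimple i (demazureSimple j v) = demazureSimple j (demazureSimple i v) := by
  refine ext_pos fun a => ?_
  simp only [pos_demazureSimple]
  grind

theorem demazureSimple_braid (i : ℕ) (v : SInf) :
    demazureSimple i (demazureSimple (i + 1) (demazureSimple i v)) =
      demazureSimple (i + 1) (demazureSimple i (demazureSimple (i + 1) v)) := by
  refine ext_pos fun a => ?_
  simp only [pos_demazureSimple]
  grind

theorem permLength_demazureSimple_mem (i : ℕ) (v : SInf) :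
    permLength v ≤ permLength (demazureSimple i v) ∧
      permLength (demazureSimple i v) ≤ permLength v + 1 := by
  rcases pos_lt_or_gt v i with h | h
  · rw [demazureSimple_of_lt h, permLength_simpleRefl_mul h]
    omega
  · rw [demazureSimple_of_gt h]
    omega

theorem permLength_demazureMul_le (a : List ℕ) (v : SInf) :
    permLength (demazureMul a v) ≤ a.length + permLength v := by
  induction a with
  | nil => simp [demazureMul]
  | cons i a ih =>
    have := (permLength_demazureSimple_mem i (demazureMul a v)).2
    rw [List.length_cons, show demazureMul (i :: a) v = demazureSimple i (demazureMul a v) from rfl]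
    omega

/-- A set of permutations closed under `s_i * ·` for the letters of a word is closed under the
product with that word. -/
theorem demazureMul_mem {S : Set SInf} {a : List ℕ}
    (hS : ∀ i ∈ a, ∀ v ∈ S, demazureSimple i v ∈ S) {v : SInf} (hv : v ∈ S) :
    demazureMul a v ∈ S := by
  induction a with
  | nil => exact hv
  | cons i a ih =>
    exact hS i (by simp) _ (ih fun j hj => hS j (by simp [hj]))

/-! ### Finiteness -/

/-- The permutations that do not preserve `{0, …, i}`; equivalently, those whose reduced words
contain the letter `i`. -/
def crossing (i : ℕ) : Set SInf := {v | ∃ p ≤ i, i < pos v p}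

theorem demazureSimple_mem_crossing_self (i : ℕ) (v : SInf) :
    demazureSimple i v ∈ crossing i := by
  by_contra hc
  have hc : ∀ p ≤ i, pos (demazureSimple i v) p ≤ i := by
    simpa [crossing] using hc
  have hmaps : Set.MapsTo (pos (demazureSimple i v)) (Finset.range (i + 1))
      (Finset.range (i + 1)) := by
    intro p hp
    simp only [Finset.coe_range, Set.mem_Iio] at hp ⊢
    have := hc p (by omega)
    omega
  -- An injective self-map of `{0, …, i}` hits the position of the value `i + 1`.
  have hsurj := Finset.surjOn_of_injOn_of_card_le _ hmaps (pos_injective _).injOn le_rfl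
  have hlt : pos (demazureSimple i v) (i + 1) < pos (demazureSimple i v) i := by
    have := pos_lt_or_gt v i
    simp only [pos_demazureSimple]
    simp
    omega
  have hi := hc i le_rfl
  obtain ⟨q, hq, hqe⟩ := hsurj (show pos (demazureSimple i v) (i + 1) ∈ _ by
    simp only [Finset.coe_range, Set.mem_Iio]; omega)
  have := pos_injective _ hqe
  simp only [Finset.coe_range, Set.mem_Iio] at hq
  omega

theorem demazureSimple_mem_crossing (i j : ℕ) {v : SInf} (hv : v ∈ crossing i) :
    demazureSimple j v ∈ crossing i := by
  by_cases hj : j = i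
  · exact hj ▸ demazureSimple_mem_crossing_self j v
  obtain ⟨p, hp, hpi⟩ := hv
  by_cases hji : p = j ∨ p = j + 1
  · refine ⟨j, by omega, ?_⟩
    rw [pos_demazureSimple, if_pos rfl]
    rcases hji with rfl | rfl
    · exact lt_max_of_lt_left hpi
    · exact lt_max_of_lt_right hpi
  · refine ⟨p, hp, ?_⟩
    rw [pos_demazureSimple]
    rwa [if_neg (by tauto), if_neg (by tauto)]

theorem demazureMul_mem_crossing {a : List ℕ} {i : ℕ} (hi : i ∈ a) (v : SInf) :
    demazureMul a v ∈ crossing i := by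
  induction a with
  | nil => simp at hi
  | cons j a ih =>
    rcases List.mem_cons.mp hi with rfl | h
    · exact demazureSimple_mem_crossing_self i _
    · exact demazureSimple_mem_crossing i j (ih h)

theorem FixesFrom.lt_of_mem_crossing {n : ℕ} {v : SInf} (hv : FixesFrom n v) {i : ℕ}
    (hi : v ∈ crossing i) : i + 1 < n := by
  obtain ⟨p, hp, hpi⟩ := hi
  by_contra hc
  rcases lt_or_ge p n with h | h
  · have := hv.pos_lt h
    omega
  · rw [hv.pos_eq h] at hpi
    omega

theorem FixesFrom.letter_lt {n : ℕ} {a : List ℕ} {v : SInf}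
    (h : FixesFrom n (demazureMul a v)) {i : ℕ} (hi : i ∈ a) : i < n := by
  have := h.lt_of_mem_crossing (demazureMul_mem_crossing hi v)
  omega

theorem FixesFrom.of_demazureMul {n : ℕ} {a : List ℕ} {v : SInf}
    (h : FixesFrom n (demazureMul a v)) : FixesFrom n v := by
  have hle : ∀ i, n ≤ i + 1 → ∀ p ≤ i, pos v p ≤ i := by
    intro i hi p hp
    by_contra hc
    have := h.lt_of_mem_crossing (i := i)
      (demazureMul_mem (fun j _ v hv => demazureSimple_mem_crossing i j hv) ⟨p, hp, not_le.mp hc⟩)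
    omega
  -- `v⁻¹` preserves `{0, …, i}` for all large `i`, hence fixes all large values.
  have hpos : ∀ i, n ≤ i → pos v i = i := by
    intro i hi
    refine le_antisymm (hle i (by omega) i le_rfl) ?_
    by_contra hc
    have hmaps : Set.MapsTo (pos v) (Finset.range (i + 1)) (Finset.range i) := by
      intro p hp
      simp only [Finset.coe_range, Set.mem_Iio] at hp ⊢
      rcases Nat.lt_succ_iff_lt_or_eq.mp hp with h1 | rfl
      · have := hle (i - 1) (by omega) p (by omega)
        omega
      · omega
    have := Finset.card_le_card_of_injOn _ hmaps (pos_injective v).injOn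
    simp at this
  intro i hi
  conv_lhs => rw [← hpos i hi]
  exact apply_pos v i

theorem finite_fixesFrom (n : ℕ) : {v | FixesFrom n v}.Finite := by
  refine Set.Finite.of_finite_image (f := fun v (i : Fin n) => pos v i)
    ((Set.Finite.pi' (t := fun _ : Fin n => Set.Iio n) fun _ => Set.finite_Iio n).subset ?_) ?_
  · rintro _ ⟨v, hv, rfl⟩ i
    exact hv.pos_lt i.2
  · intro v hv w hw h
    refine ext_pos fun i => ?_
    rcases lt_or_ge i n with hi | hi
    · exact congrFun h ⟨i, hi⟩
    · rw [FixesFrom.pos_eq hv hi, FixesFrom.pos_eq hw hi]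

/-! ### The permutation `w ⊖_m 1` -/

theorem ominus_apply (m : ℕ) (w : SInf) (i : ℕ) :
    ((ominus m w : SInf) : Equiv.Perm ℕ) i = ominusFun m w i := rfl

theorem pos_ominus_zero (m : ℕ) (w : SInf) : pos (ominus m w) 0 = m := rfl

theorem pos_ominus_succ (m : ℕ) (w : SInf) (j : ℕ) :
    pos (ominus m w) (j + 1) = if pos w j < m then pos w j else pos w j + 1 := rfl

theorem ominus_injective (m : ℕ) : Function.Injective (ominus m) := by
  intro v w h
  refine ext_pos fun j => ?_
  have := congrArg (fun u => pos u (j + 1)) h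
  simp only [pos_ominus_succ] at this
  split_ifs at this <;> omega

theorem pos_ominus_lt_iff (m : ℕ) (v : SInf) (i j : ℕ) :
    pos (ominus m v) (i + 1) < pos (ominus m v) (j + 1) ↔ pos v i < pos v j := by
  simp only [pos_ominus_succ]
  split_ifs <;> omega

/-- Left multiplication by `s_{i+1}` on `v ⊖_m 1` corresponds to left multiplication by `s_i` on `v`:
the values are shifted by one, and their positions keep their relative order. -/
theorem demazureSimple_succ_ominus (m i : ℕ) (v : SInf) :
    demazureSimple (i + 1) (ominus m v) = ominus m (demazureSimple i v) := by
  refine ext_pos fun j => ?_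
  rcases j with _ | j
  · rw [pos_demazureSimple]
    simp [pos_ominus_zero]
  · simp only [pos_demazureSimple, pos_ominus_succ]
    grind

theorem demazureMul_map_succ_ominus (m : ℕ) (a : List ℕ) (v : SInf) :
    demazureMul (a.map (· + 1)) (ominus m v) = ominus m (demazureMul a v) := by
  induction a with
  | nil => rfl
  | cons i a ih =>
    change demazureSimple (i + 1) (demazureMul (a.map (· + 1)) (ominus m v)) = _
    rw [ih, demazureSimple_succ_ominus]
    rfl

theorem ominus_zero_one : ominus 0 1 = 1 := by
  refine ext_pos fun j => ?_
  rcases j with _ | j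
  · rfl
  · rw [pos_ominus_succ]
    simp [pos_one]

theorem pos_ominus_zero_one (m : ℕ) (v : SInf) : pos (ominus 0 (ominus m v)) 1 = m + 1 := rfl

theorem simpleRefl_mul_ominus_zero (m : ℕ) :
    simpleRefl 0 * ominus 0 (ominus m 1) = ominus (m + 1) 1 := by
  refine ext_pos fun j => ?_
  rw [pos_simpleRefl_mul]
  rcases j with _ | _ | j
  · rw [Equiv.swap_apply_left]
    rfl
  · simp [pos_ominus_succ, pos_ominus_zero, pos_one]
  · rw [Equiv.swap_apply_of_ne_of_ne (by omega) (by omega)]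
    simp only [pos_ominus_succ, pos_one]
    grind

theorem demazureMul_range_one (m : ℕ) : demazureMul (List.range m) 1 = ominus m 1 := by
  induction m with
  | zero => exact ominus_zero_one.symm
  | succ m ih =>
    rw [List.range_succ_eq_map]
    change demazureSimple 0 (demazureMul ((List.range m).map (· + 1)) 1) = _
    conv_lhs => rw [← ominus_zero_one, demazureMul_map_succ_ominus, ih]
    rw [demazureSimple_of_lt, simpleRefl_mul_ominus_zero]
    rw [pos_ominus_zero, pos_ominus_zero_one]
    omega

theorem permLength_ominus (m : ℕ) (w : SInf) : permLength (ominus m w) = permLength w + m := by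
  have key : ∀ j v, permLength (ominus j v) = permLength v + permLength (ominus j 1) := by
    intro j v
    induction v using leftWeak_induction with
    | one => rw [permLength_one, zero_add]
    | mul i v hi ih =>
      have hi' := (pos_ominus_lt_iff j v i (i + 1)).mpr hi
      rw [← demazureSimple_of_lt hi, ← demazureSimple_succ_ominus, demazureSimple_of_lt hi',
        demazureSimple_of_lt hi, permLength_simpleRefl_mul hi, permLength_simpleRefl_mul hi', ih]
      omega
  rw [key, Nat.add_left_cancel_iff]
  induction m with
  | zero => rw [ominus_zero_one, permLength_one]
  | succ m ih =>
    rw [← simpleRefl_mul_ominus_zero, permLength_simpleRefl_mul, key, ih, ominus_zero_one,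
      permLength_one]
    rw [pos_ominus_zero, pos_ominus_zero_one]
    omega

theorem FixesFrom.ominus {n m : ℕ} {w : SInf} (h : FixesFrom n w) (hm : m ≤ n) :
    FixesFrom (n + 1) (ominus m w) := by
  intro i hi
  rw [ominus_apply, ominusFun, if_neg (by omega), if_neg (by omega), h _ (by omega)]
  omega

/-! ### Descents -/

/-- The permutations having a descent at a position `≥ m`. -/
def descentFrom (m : ℕ) : Set SInf := {v | ∃ i ∈ descents v, m ≤ i}

/-- A left multiplication that increases the length does not remove right descents. -/
theorem demazureSimple_mem_descentFrom (m i : ℕ) {v : SInf} (hv : v ∈ descentFrom m) :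
    demazureSimple i v ∈ descentFrom m := by
  rcases pos_lt_or_gt v i with h | h
  · obtain ⟨p, hp, hm⟩ := hv
    refine ⟨p, ?_, hm⟩
    rw [demazureSimple_of_lt h]
    refine swap_succ_lt hp ?_
    rintro ⟨h1, h2⟩
    rw [← h1, pos_apply, h1, ← h2, pos_apply] at h
    omega
  · rwa [demazureSimple_of_gt h]

theorem demazureSimple_one_mem_descentFrom {m i : ℕ} (h : m ≤ i) :
    demazureSimple i 1 ∈ descentFrom m := by
  refine ⟨i, ?_, h⟩
  rw [demazureSimple_of_lt (by simp [pos_one])]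
  change Equiv.swap i (i + 1) (i + 1) < Equiv.swap i (i + 1) i
  rw [Equiv.swap_apply_left, Equiv.swap_apply_right]
  omega

theorem ominus_notMem_descentFrom {m : ℕ} {w : SInf} (hw : w ∉ descentFrom m) :
    ominus m w ∉ descentFrom m := by
  rintro ⟨i, hi, hm⟩
  change ominusFun m w (i + 1) < ominusFun m w i at hi
  unfold ominusFun at hi
  rw [if_neg (by omega), if_neg (by omega), if_neg (by omega)] at hi
  split_ifs at hi with h
  · omega
  · refine hw ⟨i - 1, ?_, by omega⟩
    change (w : Equiv.Perm ℕ) (i - 1 + 1) < (w : Equiv.Perm ℕ) (i - 1)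
    rw [Nat.sub_add_cancel (by omega)]
    simpa using hi

/-- The permutations whose value at position `m` is at least `r`. -/
def valueGe (m r : ℕ) : Set SInf := {v | r ≤ (v : Equiv.Perm ℕ) m}

theorem demazureSimple_mem_valueGe {m r i : ℕ} (hi : i + 1 ≠ r) {v : SInf} (hv : v ∈ valueGe m r) :
    demazureSimple i v ∈ valueGe m r := by
  rcases pos_lt_or_gt v i with h | h
  · have hv : r ≤ (v : Equiv.Perm ℕ) m := hv
    rw [demazureSimple_of_lt h]
    change r ≤ Equiv.swap i (i + 1) ((v : Equiv.Perm ℕ) m)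
    rw [Equiv.swap_apply_def]
    split_ifs <;> omega
  · rwa [demazureSimple_of_gt h]

/-! ### The Yang–Baxter calculus in a `0`-Hecke algebra -/

section YangBaxter

variable {R A : Type*} [CommRing R] [Ring A] [Algebra R A]

/-- The defining relations of the `0`-Hecke algebra of `S_∞` with parameter `β`. -/
structure HeckeRelations (β : R) (e : ℕ → A) : Prop where
  sq : ∀ i, e i * e i = β • e i
  comm : ∀ i j, i + 2 ≤ j → e i * e j = e j * e i
  braid : ∀ i, e i * e (i + 1) * e i = e (i + 1) * e i * e (i + 1)

/-- The factor `h_i(x) = 1 + x e_i`. -/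
def linFactor (e : ℕ → A) (x : R) (i : ℕ) : A := 1 + x • e i

/-- The product `h_{i+k-1}(x) ⋯ h_{i+1}(x) h_i(x)`. -/
def descProd (e : ℕ → A) (x : R) (i k : ℕ) : A :=
  ((List.range' i k).reverse.map (linFactor e x)).prod

/-- The product `h_i(y) h_{i+1}(y) ⋯ h_{i+k-1}(y)`. -/
def ascProd (e : ℕ → A) (y : R) (i k : ℕ) : A :=
  ((List.range' i k).map (linFactor e y)).prod

theorem descProd_succ (e : ℕ → A) (x : R) (i k : ℕ) :
    descProd e x i (k + 1) = descProd e x (i + 1) k * linFactor e x i := by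
  simp [descProd, List.range'_succ]

theorem ascProd_succ (e : ℕ → A) (y : R) (i k : ℕ) :
    ascProd e y i (k + 1) = linFactor e y i * ascProd e y (i + 1) k := by
  simp [ascProd, List.range'_succ]

variable {β : R} {e : ℕ → A}

theorem HeckeRelations.commute (he : HeckeRelations β e) {i j : ℕ} (h : i + 2 ≤ j) (x : R) :
    Commute (e i) (linFactor e x j) :=
  (Commute.one_right _).add_right (Commute.smul_right (he.comm i j h) x)

theorem HeckeRelations.commute_linFactor (he : HeckeRelations β e) {i j : ℕ} (h : i + 2 ≤ j)
    (x y : R) : Commute (linFactor e x i) (linFactor e y j) :=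
  (Commute.one_left _).add_left (Commute.smul_left (he.commute h y) x)

theorem HeckeRelations.commute_descProd (he : HeckeRelations β e) {i j : ℕ} (h : i + 2 ≤ j)
    (x : R) (k : ℕ) : Commute (e i) (descProd e x j k) := by
  refine Commute.list_prod_right _ _ fun a ha => ?_
  simp only [List.mem_map, List.mem_reverse, List.mem_range'_1] at ha
  obtain ⟨l, hl, rfl⟩ := ha
  exact he.commute (by omega) x

theorem HeckeRelations.commute_linFactor_descProd (he : HeckeRelations β e) {i j : ℕ}
    (h : i + 2 ≤ j) (x y : R) (k : ℕ) : Commute (linFactor e y i) (descProd e x j k) :=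
  (Commute.one_left _).add_left (Commute.smul_left (he.commute_descProd h x k) y)

theorem HeckeRelations.commute_linFactor_ascProd (he : HeckeRelations β e) {i j : ℕ}
    (h : i + 2 ≤ j) (x y : R) (k : ℕ) : Commute (linFactor e y i) (ascProd e x j k) := by
  refine Commute.list_prod_right _ _ fun a ha => ?_
  simp only [List.mem_map, List.mem_range'_1] at ha
  obtain ⟨l, hl, rfl⟩ := ha
  exact he.commute_linFactor (by omega) y x

theorem HeckeRelations.linFactor_mul_self (he : HeckeRelations β e) (i : ℕ) (x y : R) :
    linFactor e y i * linFactor e x i = linFactor e (x + y + β * x * y) i := by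
  simp only [linFactor, mul_add, add_mul, one_mul, mul_one, smul_mul_assoc, mul_smul_comm, he.sq]
  module

theorem HeckeRelations.yangBaxter (he : HeckeRelations β e) (i : ℕ) (x y : R) :
    linFactor e y i * linFactor e (x + y + β * x * y) (i + 1) * linFactor e x i =
      linFactor e x (i + 1) * linFactor e (x + y + β * x * y) i * linFactor e y (i + 1) := by
  have hb := he.braid i
  simp only [linFactor, mul_add, add_mul, one_mul, mul_one, smul_mul_assoc, mul_smul_comm, he.sq,
    hb]
  module

/-- Moving an increasing product past a decreasing one: both lose the factor at `i`, and a factor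
with parameter `x ⊕ y = x + y + β x y` appears between them. -/
theorem HeckeRelations.ascProd_mul_descProd (he : HeckeRelations β e) (x y : R) (i k : ℕ) :
    ascProd e y i (k + 1) * descProd e x i (k + 1) =
      descProd e x (i + 1) k * linFactor e (x + y + β * x * y) i * ascProd e y (i + 1) k := by
  induction k generalizing i with
  | zero =>
    simpa [ascProd, descProd] using he.linFactor_mul_self i x y
  | succ k ih =>
    have h1 := (he.commute_linFactor_descProd (le_refl (i + 2)) x y k).eq
    have h2 := (he.commute_linFactor_ascProd (le_refl (i + 2)) y x k).eq
    have h3 := he.yangBaxter i x y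
    calc ascProd e y i (k + 2) * descProd e x i (k + 2)
        = linFactor e y i * (ascProd e y (i + 1) (k + 1) * descProd e x (i + 1) (k + 1)) *
            linFactor e x i := by
          rw [ascProd_succ, descProd_succ]
          simp only [mul_assoc]
      _ = (linFactor e y i * descProd e x (i + 2) k) *
            linFactor e (x + y + β * x * y) (i + 1) *
            (ascProd e y (i + 2) k * linFactor e x i) := by
          rw [ih]
          simp only [mul_assoc]
      _ = descProd e x (i + 2) k * (linFactor e y i *
            linFactor e (x + y + β * x * y) (i + 1) * linFactor e x i) *
            ascProd e y (i + 2) k := by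
          rw [h1, ← h2]
          simp only [mul_assoc]
      _ = _ := by
          rw [h3, descProd_succ, ascProd_succ]
          simp only [mul_assoc]

/-- The row `r` of the pipe dreams in the staircase of size `n`: the product
`h_{n-1}(x_r) ⋯ h_r(x_r)`. -/
def stairRow (e : ℕ → A) (x : ℕ → R) (n r : ℕ) : A := descProd e (x r) r (n - r)

/-- The row `r` of the staircase of size `n`, with the variable of the first column (the last
letter `r`) replaced by `z_r`: the product `h_{n-1}(x_r) ⋯ h_{r+1}(x_r) h_r(z_r)`. -/
def markedRow (e : ℕ → A) (x z : ℕ → R) (n r : ℕ) : A :=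
  descProd e (x r) (r + 1) (n - (r + 1)) * linFactor e (z r) r

theorem HeckeRelations.ascProd_mul_stair (he : HeckeRelations β e) (x : ℕ → R) (y : R) (n : ℕ) :
    ascProd e y 0 n * ((List.range n).map (stairRow e x n)).prod =
      ((List.range n).map (markedRow e x (fun r => x r + y + β * x r * y) n)).prod := by
  have key : ∀ k r, r + k = n → ascProd e y r k * ((List.range' r k).map (stairRow e x n)).prod =
      ((List.range' r k).map (markedRow e x (fun r => x r + y + β * x r * y) n)).prod := by
    intro k
    induction k with
    | zero => simp [ascProd]
    | succ k ih =>
      intro r hr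
      rw [List.range'_succ, List.map_cons, List.map_cons, List.prod_cons, List.prod_cons,
        ← ih (r + 1) (by omega), stairRow, markedRow, show n - r = k + 1 by omega,
        show n - (r + 1) = k by omega, ← mul_assoc, he.ascProd_mul_descProd]
      simp only [mul_assoc]
  rw [List.range_eq_range']
  exact key n 0 (by omega)

/-- Expansion of a product of factors `1 + x_p f_p` over the subsets of the index list. -/
theorem prod_map_one_add_smul {α : Type*} [DecidableEq α] (x : α → R) (f : α → A) {L : List α}
    (hL : L.Nodup) :
    (L.map fun p => 1 + x p • f p).prod = ∑ P ∈ L.toFinset.powerset,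
      (∏ p ∈ P, x p) • ((L.filter (· ∈ P)).map f).prod := by
  induction L with
  | nil => simp
  | cons q L ih =>
    obtain ⟨hq, hL⟩ := List.nodup_cons.mp hL
    have hq' : q ∉ L.toFinset := by simpa using hq
    rw [List.map_cons, List.prod_cons, ih hL, List.toFinset_cons, Finset.sum_powerset_insert hq',
      add_mul, one_mul]
    congr 1
    · refine Finset.sum_congr rfl fun P hP => ?_
      have : q ∉ P := fun h => hq' (Finset.mem_powerset.mp hP h)
      simp [this]
    · rw [Finset.mul_sum]
      refine Finset.sum_congr rfl fun P hP => ?_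
      have hqP : q ∉ P := fun h => hq' (Finset.mem_powerset.mp hP h)
      have hfil : L.filter (· ∈ insert q P) = L.filter (· ∈ P) := by
        refine List.filter_congr fun p hp => ?_
        have : p ≠ q := fun h => hq (h ▸ hp)
        simp [this]
      rw [Finset.prod_insert hqP, List.filter_cons_of_pos (by simp), hfil, List.map_cons,
        List.prod_cons, smul_mul_smul_comm]

end YangBaxter

/-! ### The `0`-Hecke operators -/

section Operators

variable {R : Type*} [CommRing R] (β : R)

/-- Left multiplication by the generator `e_i` of the `0`-Hecke algebra with parameter `β`, acting on
the free module with basis `S_∞`: it sends `v` to `s_i v` if this is longer, and to `β v` if not.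
The subtraction in the exponent does not truncate, since `ℓ(s_i * v) ≤ ℓ(v) + 1`. -/
noncomputable def heckeGen (i : ℕ) : Module.End R (SInf →₀ R) :=
  Finsupp.linearCombination R fun v =>
    Finsupp.single (demazureSimple i v) (β ^ (1 + permLength v - permLength (demazureSimple i v)))

theorem heckeGen_single (i : ℕ) (v : SInf) (c : R) :
    heckeGen β i (Finsupp.single v c) = Finsupp.single (demazureSimple i v)
      (β ^ (1 + permLength v - permLength (demazureSimple i v)) * c) := by
  simp [heckeGen, Finsupp.linearCombination_single, mul_comm]

theorem heckeWord_single (a : List ℕ) (v : SInf) (c : R) :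
    (a.map (heckeGen β)).prod (Finsupp.single v c) = Finsupp.single (demazureMul a v)
      (β ^ (a.length + permLength v - permLength (demazureMul a v)) * c) := by
  induction a with
  | nil => simp [demazureMul]
  | cons i a ih =>
    rw [List.map_cons, List.prod_cons, Module.End.mul_apply, ih, heckeGen_single, ← mul_assoc,
      ← pow_add]
    have h1 := (permLength_demazureSimple_mem i (demazureMul a v)).2
    have h2 := permLength_demazureMul_le a v
    congr 3
    rw [List.length_cons, show demazureMul (i :: a) v = demazureSimple i (demazureMul a v) from rfl]
    omega

theorem heckeWord_congr {a b : List ℕ} (hlen : a.length = b.length)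
    (h : ∀ v, demazureMul a v = demazureMul b v) :
    (a.map (heckeGen β)).prod = (b.map (heckeGen β)).prod := by
  refine Finsupp.lhom_ext fun v c => ?_
  rw [heckeWord_single, heckeWord_single, h, hlen]

theorem heckeRelations : HeckeRelations β (heckeGen β) where
  sq i := by
    refine Finsupp.lhom_ext fun v c => ?_
    have h1 := permLength_demazureSimple_mem i v
    rw [Module.End.mul_apply, LinearMap.smul_apply, heckeGen_single, heckeGen_single,
      demazureSimple_idem, Finsupp.smul_single, smul_eq_mul, ← mul_assoc, ← pow_add,
      ← mul_assoc, ← pow_succ']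
    congr 3
    omega
  comm i j h := by
    have := heckeWord_congr β (a := [i, j]) (b := [j, i]) rfl fun v => demazureSimple_comm h v
    simpa using this
  braid i := by
    have := heckeWord_congr β (a := [i, i + 1, i]) (b := [i + 1, i, i + 1]) rfl
      fun v => demazureSimple_braid i v
    simpa [mul_assoc] using this

theorem heckeGen_mem_supported {S : Set SInf} {i : ℕ} (hS : ∀ v ∈ S, demazureSimple i v ∈ S)
    {f : SInf →₀ R} (hf : f ∈ Finsupp.supported R R S) :
    heckeGen β i f ∈ Finsupp.supported R R S := by
  rw [heckeGen, Finsupp.linearCombination_apply]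
  refine Submodule.sum_mem _ fun v hv => Submodule.smul_mem _ _ ?_
  exact Finsupp.single_mem_supported R _ (hS v ((Finsupp.mem_supported R f).mp hf hv))

section Stabilizes

variable {M : Type*} [AddCommGroup M] [Module R M]

/-- The endomorphism `f` maps the submodule `W` into itself. -/
def Stabilizes (f : Module.End R M) (W : Submodule R M) : Prop := ∀ w ∈ W, f w ∈ W

/-- The endomorphism `f` preserves `W` and fixes `v` modulo `W`. -/
def FixesMod (f : Module.End R M) (W : Submodule R M) (v : M) : Prop :=
  Stabilizes f W ∧ f v - v ∈ W

variable {W : Submodule R M} {v : M}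

theorem Stabilizes.list_prod {l : List (Module.End R M)} (h : ∀ f ∈ l, Stabilizes f W) :
    Stabilizes l.prod W := by
  induction l with
  | nil => exact fun w hw => hw
  | cons f l ih =>
    rw [List.prod_cons]
    exact fun w hw => h f (by simp) _ (ih (fun g hg => h g (by simp [hg])) w hw)

theorem FixesMod.mul {f g : Module.End R M} (hf : FixesMod f W v) (hg : FixesMod g W v) :
    FixesMod (f * g) W v := by
  refine ⟨fun w hw => hf.1 _ (hg.1 w hw), ?_⟩
  have := W.add_mem (hf.1 _ hg.2) hf.2
  rwa [map_sub, sub_add_sub_cancel] at this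

theorem FixesMod.list_prod {l : List (Module.End R M)} (h : ∀ f ∈ l, FixesMod f W v) :
    FixesMod l.prod W v := by
  induction l with
  | nil => exact ⟨fun w hw => hw, by simp⟩
  | cons f l ih =>
    rw [List.prod_cons]
    exact (h f (by simp)).mul (ih fun g hg => h g (by simp [hg]))

variable {e : ℕ → Module.End R M}

theorem Stabilizes.linFactor {i : ℕ} (h : Stabilizes (e i) W) (x : R) :
    Stabilizes (linFactor e x i) W :=
  fun w hw => W.add_mem hw (W.smul_mem x (h w hw))

theorem Stabilizes.descProd {i : ℕ} (h : ∀ j, i ≤ j → Stabilizes (e j) W) (x : R) (k : ℕ) :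
    Stabilizes (descProd e x i k) W := by
  refine Stabilizes.list_prod fun a ha => ?_
  simp only [List.mem_map, List.mem_reverse, List.mem_range'_1] at ha
  obtain ⟨l, hl, rfl⟩ := ha
  exact (h l hl.1).linFactor x

theorem Stabilizes.markedRow {r : ℕ} (h : ∀ j, r ≤ j → Stabilizes (e j) W) (x z : ℕ → R) (n : ℕ) :
    Stabilizes (markedRow e x z n r) W := fun w hw =>
  Stabilizes.descProd (fun j hj => h j (Nat.le_of_succ_le hj)) _ _ _
    ((h r le_rfl).linFactor (z r) w hw)

theorem FixesMod.descProd {i : ℕ} {x : R} (h : ∀ j, i ≤ j → FixesMod (linFactor e x j) W v)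
    (k : ℕ) : FixesMod (descProd e x i k) W v := by
  refine FixesMod.list_prod fun a ha => ?_
  simp only [List.mem_map, List.mem_reverse, List.mem_range'_1] at ha
  obtain ⟨l, hl, rfl⟩ := ha
  exact h l hl.1

theorem apply_linFactor_sub {i : ℕ} {P : Module.End R M} (D : Module.End R M) (z c : R) (b : M)
    (h : P (e i v) = e i (P v)) :
    D (linFactor e z i b) - (z * c) • D (P (e i v)) =
      D (linFactor e z i (b - c • P v)) + D (c • P v) := by
  simp only [PipeDream.linFactor, LinearMap.add_apply, Module.End.one_apply, LinearMap.smul_apply,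
    map_add, map_sub, map_smul, h]
  module

end Stabilizes

/-- The permutations with a descent at a position `≥ m` span a left ideal. -/
theorem heckeGen_stabilizes_descentFrom (m i : ℕ) :
    Stabilizes (heckeGen β i) (Finsupp.supported R R (descentFrom m)) := fun _ hf =>
  heckeGen_mem_supported β (fun _ hv => demazureSimple_mem_descentFrom m i hv) hf

theorem heckeGen_stabilizes_valueGe {m r i : ℕ} (hi : i + 1 ≠ r) :
    Stabilizes (heckeGen β i) (Finsupp.supported R R (valueGe m r)) := fun _ hf =>
  heckeGen_mem_supported β (fun _ hv => demazureSimple_mem_valueGe hi hv) hf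

theorem linFactor_fixesMod {m i : ℕ} (h : m ≤ i) (x : R) :
    FixesMod (linFactor (heckeGen β) x i) (Finsupp.supported R R (descentFrom m))
      (Finsupp.single 1 1) := by
  refine ⟨(heckeGen_stabilizes_descentFrom β m i).linFactor x, ?_⟩
  rw [linFactor, LinearMap.add_apply, Module.End.one_apply, add_sub_cancel_left,
    LinearMap.smul_apply, heckeGen_single]
  exact Submodule.smul_mem _ _
    (Finsupp.single_mem_supported R _ (demazureSimple_one_mem_descentFrom h))

theorem descProd_fixesMod {m i : ℕ} (h : m ≤ i) (x : R) (k : ℕ) :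
    FixesMod (descProd (heckeGen β) x i k) (Finsupp.supported R R (descentFrom m))
      (Finsupp.single 1 1) :=
  FixesMod.descProd (fun _ hj => linFactor_fixesMod β (h.trans hj) x) k

theorem eq_zero_of_mem_supported {S : Set SInf} {f : SInf →₀ R}
    (hf : f ∈ Finsupp.supported R R S) {v : SInf} (hv : v ∉ S) : f v = 0 :=
  (Finsupp.mem_supported' R f).mp hf v hv

/-- In a product of rows, only the first `m` rows matter for the coefficient of a permutation all of
whose descents are less than `m`, since all other letters are at least `m`. -/
theorem prod_rows_apply {m n : ℕ} (hmn : m ≤ n) (row : ℕ → Module.End R (SInf →₀ R))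
    (hrow : ∀ r, Stabilizes (row r) (Finsupp.supported R R (descentFrom m)))
    (hfix : ∀ r, m ≤ r → FixesMod (row r) (Finsupp.supported R R (descentFrom m))
      (Finsupp.single 1 1))
    {v : SInf} (hv : v ∉ descentFrom m) :
    ((List.range n).map row).prod (Finsupp.single 1 1) v =
      ((List.range m).map row).prod (Finsupp.single 1 1) v := by
  obtain ⟨k, rfl⟩ := Nat.exists_eq_add_of_le hmn
  have hk : FixesMod ((List.range' m k).map row).prod (Finsupp.supported R R (descentFrom m))
      (Finsupp.single 1 1) := by
    refine FixesMod.list_prod fun a ha => ?_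
    simp only [List.mem_map, List.mem_range'_1] at ha
    obtain ⟨r, hr, rfl⟩ := ha
    exact hfix r hr.1
  have hm : Stabilizes ((List.range m).map row).prod
      (Finsupp.supported R R (descentFrom m)) := by
    refine Stabilizes.list_prod fun a ha => ?_
    simp only [List.mem_map] at ha
    obtain ⟨r, -, rfl⟩ := ha
    exact hrow r
  have h0 := eq_zero_of_mem_supported (hm _ hk.2) hv
  rw [map_sub, Finsupp.sub_apply, sub_eq_zero] at h0
  rw [← h0, ← Module.End.mul_apply, ← List.prod_append, ← List.map_append,
    List.range_eq_range', List.range_eq_range']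
  congr 4
  simpa using (List.range'_append (s := 0) (m := m) (n := k) (step := 1)).symm

/-- Modulo the permutations whose value at `m` exceeds `r`, the marked factor of each of the rows
`r, …, m - 1` contributes its letter, and these letters can be moved to the right. -/
theorem prod_markedRow_sub_mem (x z : ℕ → R) (m n k : ℕ) : ∀ r, r + k = m →
    ((List.range' r k).map (markedRow (heckeGen β) x z n)).prod (Finsupp.single 1 1) -
      ((List.range' r k).map z).prod •
        ((List.range' r k).map fun i => descProd (heckeGen β) (x i) (i + 1) (n - (i + 1))).prod
          (((List.range' r k).map (heckeGen β)).prod (Finsupp.single 1 1)) ∈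
      Finsupp.supported R R (valueGe m (r + 1)) := by
  induction k with
  | zero => simp
  | succ k ih =>
    intro r hr
    have ih := ih (r + 1) (by omega)
    have hone : Finsupp.single (1 : SInf) (1 : R) ∈ Finsupp.supported R R (valueGe m (r + 1)) :=
      Finsupp.single_mem_supported R _ (show r + 1 ≤ m by omega)
    simp only [List.range'_succ, List.map_cons, List.prod_cons, Module.End.mul_apply]
    set e := heckeGen β
    set D := descProd e (x r) (r + 1) (n - (r + 1)) with hD
    set B := ((List.range' (r + 1) k).map (markedRow e x z n)).prod (Finsupp.single 1 1)
    set P := ((List.range' (r + 1) k).map fun i => descProd e (x i) (i + 1) (n - (i + 1))).prod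
      with hP
    set E := ((List.range' (r + 1) k).map e).prod with hE
    set c := ((List.range' (r + 1) k).map z).prod
    have hge : ∀ j, r + 1 ≤ j → Stabilizes (e j) (Finsupp.supported R R (valueGe m (r + 1))) :=
      fun j hj => heckeGen_stabilizes_valueGe β (by omega)
    have hDstab : Stabilizes D (Finsupp.supported R R (valueGe m (r + 1))) :=
      Stabilizes.descProd hge _ _
    have hPstab : Stabilizes P (Finsupp.supported R R (valueGe m (r + 1))) := by
      refine Stabilizes.list_prod fun a ha => ?_
      simp only [List.mem_map, List.mem_range'_1] at ha
      obtain ⟨i, hi, rfl⟩ := ha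
      exact Stabilizes.descProd (fun j hj => hge j (by omega)) _ _
    have hEstab : Stabilizes E (Finsupp.supported R R (valueGe m (r + 1))) := by
      refine Stabilizes.list_prod fun a ha => ?_
      simp only [List.mem_map, List.mem_range'_1] at ha
      obtain ⟨i, hi, rfl⟩ := ha
      exact hge i hi.1
    have hcomm : Commute (e r) P := by
      refine Commute.list_prod_right _ _ fun a ha => ?_
      simp only [List.mem_map, List.mem_range'_1] at ha
      obtain ⟨i, hi, rfl⟩ := ha
      exact (heckeRelations β).commute_descProd (by omega) _ _
    have hcomm' : P (e r (E (Finsupp.single 1 1))) = e r (P (E (Finsupp.single 1 1))) := by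
      rw [← Module.End.mul_apply, ← hcomm.eq, Module.End.mul_apply]
    -- The part of the remaining rows that is already negligible stays so.
    have h1 : D (linFactor e (z r) r (B - c • P (E (Finsupp.single 1 1)))) ∈
        Finsupp.supported R R (valueGe m (r + 1)) := by
      have her : Stabilizes (e r) (Finsupp.supported R R (valueGe m (r + 1 + 1))) :=
        heckeGen_stabilizes_valueGe β (by omega)
      have hsub : valueGe m (r + 1 + 1) ⊆ valueGe m (r + 1) := fun v hv => Nat.le_of_succ_le hv
      exact hDstab _ (Finsupp.supported_mono hsub (her.linFactor (z r) _ ih))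
    -- If the letter `r` is not chosen in row `r`, it never occurs.
    have h2 : D (c • P (E (Finsupp.single 1 1))) ∈ Finsupp.supported R R (valueGe m (r + 1)) :=
      hDstab _ (Submodule.smul_mem _ _ (hPstab _ (hEstab _ hone)))
    have hrow : markedRow e x z n r B = D (linFactor e (z r) r B) := rfl
    rw [hrow, apply_linFactor_sub D (z r) c B hcomm']
    exact Submodule.add_mem _ h1 h2

/-- The linear extension of `v ↦ v ⊖_m 1`. -/
noncomputable def ominusMap (R : Type*) [CommRing R] (m : ℕ) : (SInf →₀ R) →ₗ[R] (SInf →₀ R) :=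
  Finsupp.lmapDomain R R (ominus m)

theorem heckeGen_succ_ominusMap (m i : ℕ) (f : SInf →₀ R) :
    heckeGen β (i + 1) (ominusMap R m f) = ominusMap R m (heckeGen β i f) := by
  have : heckeGen β (i + 1) ∘ₗ ominusMap R m = ominusMap R m ∘ₗ heckeGen β i := by
    refine Finsupp.lhom_ext fun v c => ?_
    simp only [LinearMap.comp_apply, ominusMap, Finsupp.lmapDomain_apply, Finsupp.mapDomain_single,
      heckeGen_single, demazureSimple_succ_ominus, permLength_ominus]
    congr 3
    omega
  exact LinearMap.congr_fun this f

theorem list_prod_ominusMap {ι : Type*} (m : ℕ) (l : List ι)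
    (F G : ι → Module.End R (SInf →₀ R))
    (h : ∀ i ∈ l, ∀ f, F i (ominusMap R m f) = ominusMap R m (G i f)) (f : SInf →₀ R) :
    (l.map F).prod (ominusMap R m f) = ominusMap R m ((l.map G).prod f) := by
  induction l with
  | nil => rfl
  | cons i l ih =>
    rw [List.map_cons, List.map_cons, List.prod_cons, List.prod_cons, Module.End.mul_apply,
      Module.End.mul_apply, ih fun j hj => h j (by simp [hj]), h i (by simp)]

theorem descProd_succ_ominusMap (m i k : ℕ) (x : R) (f : SInf →₀ R) :
    descProd (heckeGen β) x (i + 1) k (ominusMap R m f) =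
      ominusMap R m (descProd (heckeGen β) x i k f) := by
  have : (List.range' (i + 1) k).reverse = (List.range' i k).reverse.map (· + 1) := by
    rw [List.map_reverse, add_comm i 1, ← List.map_add_range']
    simp only [add_comm]
  rw [descProd, this, List.map_map]
  refine list_prod_ominusMap m _ _ _ (fun j _ f => ?_) f
  simp only [Function.comp_apply, linFactor, LinearMap.add_apply, Module.End.one_apply,
    LinearMap.smul_apply, heckeGen_succ_ominusMap, map_add, map_smul]

/-- The coefficient of `w ⊖_m 1` in the staircase product with marked first column. -/
theorem prod_markedRow_apply_ominus {m n : ℕ} (hmn : m ≤ n) (x z : ℕ → R) {w : SInf}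
    (hw : w ∉ descentFrom m) :
    ((List.range (n + 1)).map (markedRow (heckeGen β) x z (n + 1))).prod (Finsupp.single 1 1)
        (ominus m w) =
      (∏ r ∈ Finset.range m, z r) *
        ((List.range n).map (stairRow (heckeGen β) x n)).prod (Finsupp.single 1 1) w := by
  have hstab := heckeGen_stabilizes_descentFrom β m
  rw [prod_rows_apply (hmn.trans n.le_succ) (markedRow (heckeGen β) x z (n + 1))
      (fun r => Stabilizes.markedRow (fun j _ => hstab j) x z _)
      (fun r hr => (descProd_fixesMod β (by omega) _ _).mul (linFactor_fixesMod β hr _))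
      (ominus_notMem_descentFrom hw),
    prod_rows_apply hmn (stairRow (heckeGen β) x n)
      (fun r => Stabilizes.descProd (fun j _ => hstab j) _ _)
      (fun r hr => descProd_fixesMod β hr _ _) hw]
  have hval : ominus m w ∉ valueGe m 1 := by
    change ¬ 1 ≤ ominusFun m w m
    simp [ominusFun]
  have h0 := eq_zero_of_mem_supported
    (prod_markedRow_sub_mem β x z m (n + 1) m 0 (by omega)) hval
  rw [← List.range_eq_range', Finsupp.sub_apply, sub_eq_zero] at h0
  have hone : ((List.range m).map (heckeGen β)).prod (Finsupp.single 1 1) =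
      ominusMap R m (Finsupp.single 1 1) := by
    rw [heckeWord_single, demazureMul_range_one, ominusMap, Finsupp.lmapDomain_apply,
      Finsupp.mapDomain_single]
    simp [permLength_ominus, permLength_one]
  rw [h0, hone, list_prod_ominusMap m _ _ (stairRow (heckeGen β) x n), Finsupp.smul_apply,
    ominusMap, Finsupp.lmapDomain_apply, Finsupp.mapDomain_apply (ominus_injective m), smul_eq_mul]
  · congr 1
  · intro i _ f
    rw [descProd_succ_ominusMap, stairRow, Nat.add_sub_add_right]

end Operators

/-! ### Pipe dreams in a staircase -/

/-- The key by which `word` sorts the positions: rows from top to bottom, each from right to left. -/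
def readingKey (p : ℕ × ℕ) : ℕ ×ₗ ℕᵒᵈ := toLex (p.1, OrderDual.toDual p.2)

theorem readingKey_injective : Function.Injective readingKey := by
  rintro ⟨a, b⟩ ⟨c, d⟩ h
  have h : (a, OrderDual.toDual b) = (c, OrderDual.toDual d) := toLex.injective h
  simpa using h

/-- The positions `(r, c)` with `r + c < n`, in reading order. -/
def stairList (n : ℕ) : List (ℕ × ℕ) :=
  (List.range n).flatMap fun r => (List.range' r (n - r)).reverse.map fun l => (r, l - r)

theorem mem_stairList {n : ℕ} {p : ℕ × ℕ} : p ∈ stairList n ↔ p.1 + p.2 < n := by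
  obtain ⟨a, b⟩ := p
  simp only [stairList, List.mem_flatMap, List.mem_range, List.mem_map, List.mem_reverse,
    List.mem_range'_1, Prod.mk.injEq]
  constructor
  · rintro ⟨r, hr, l, hl, rfl, rfl⟩
    omega
  · intro h
    exact ⟨a, by omega, a + b, by omega, rfl, by omega⟩

theorem pairwise_stairList (n : ℕ) :
    (stairList n).Pairwise fun p q => readingKey p < readingKey q := by
  rw [stairList, List.pairwise_flatMap]
  constructor
  · intro r _
    rw [List.pairwise_map, List.pairwise_reverse]
    refine (List.pairwise_lt_range' (s := r)).imp_of_mem fun {a b} ha _ hab => ?_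
    simp only [List.mem_range'_1] at ha
    refine Prod.Lex.toLex_lt_toLex.mpr (Or.inr ⟨rfl, OrderDual.toDual_lt_toDual.mpr ?_⟩)
    omega
  · refine List.pairwise_lt_range.imp fun {a b} hab => ?_
    intro p hp q hq
    simp only [List.mem_map] at hp hq
    obtain ⟨_, _, rfl⟩ := hp
    obtain ⟨_, _, rfl⟩ := hq
    exact Prod.Lex.toLex_lt_toLex.mpr (Or.inl hab)

theorem nodup_stairList (n : ℕ) : (stairList n).Nodup :=
  (pairwise_stairList n).imp fun h => by
    rintro rfl
    exact lt_irrefl _ h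

theorem word_eq_map_filter {n : ℕ} {P : Finset (ℕ × ℕ)} (hP : P ⊆ (stairList n).toFinset) :
    word P = ((stairList n).filter (· ∈ P)).map fun p => p.1 + p.2 := by
  have hpair : (((stairList n).filter (· ∈ P)).map readingKey).Pairwise (· < ·) :=
    List.pairwise_map.mpr ((pairwise_stairList n).filter _)
  have himg : P.image readingKey = (((stairList n).filter (· ∈ P)).map readingKey).toFinset := by
    ext k
    simp only [Finset.mem_image, List.mem_toFinset, List.mem_map, List.mem_filter,
      decide_eq_true_eq]
    constructor
    · rintro ⟨p, hp, rfl⟩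
      exact ⟨p, ⟨List.mem_toFinset.mp (hP hp), hp⟩, rfl⟩
    · rintro ⟨p, ⟨_, hp⟩, rfl⟩
      exact ⟨p, hp, rfl⟩
  have hsort : (P.image readingKey).sort = ((stairList n).filter (· ∈ P)).map readingKey := by
    rw [himg, List.toFinset_sort _ (hpair.imp ne_of_lt)]
    exact hpair.imp le_of_lt
  change ((P.image readingKey).sort).map _ = _
  rw [hsort, List.map_map]
  rfl

theorem length_word (P : Finset (ℕ × ℕ)) : (word P).length = P.card := by
  change (((P.image readingKey).sort).map _).length = _
  rw [List.length_map, Finset.length_sort, Finset.card_image_of_injective _ readingKey_injective]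

theorem mem_word {P : Finset (ℕ × ℕ)} {p : ℕ × ℕ} (hp : p ∈ P) : p.1 + p.2 ∈ word P := by
  change _ ∈ ((P.image readingKey).sort).map _
  exact List.mem_map.mpr
    ⟨readingKey p, (Finset.mem_sort _).mpr (Finset.mem_image_of_mem _ hp), rfl⟩

theorem FixesFrom.subset_stair {n : ℕ} {v : SInf} (h : FixesFrom n v) {P : Finset (ℕ × ℕ)}
    (hP : P ∈ pipeDreams v) : P ⊆ (stairList n).toFinset := by
  intro p hp
  rw [List.mem_toFinset, mem_stairList]
  have hP : demazureMul (word P) 1 = v := hP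
  exact FixesFrom.letter_lt (hP ▸ h) (mem_word hp)

theorem FixesFrom.pipeDreams_eq {n : ℕ} {v : SInf} (h : FixesFrom n v) [DecidableEq SInf] :
    pipeDreams v = ↑((stairList n).toFinset.powerset.filter fun P => demazure (word P) = v) := by
  ext P
  simp only [Finset.coe_filter, Finset.mem_powerset, Set.mem_ofPred_eq]
  exact ⟨fun hP => ⟨h.subset_stair hP, hP⟩, fun hP => hP.2⟩

theorem finite_pipeDreams (v : SInf) : (pipeDreams v).Finite := by
  classical
  obtain ⟨n, hn⟩ := exists_fixesFrom v
  rw [hn.pipeDreams_eq]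
  exact Finset.finite_toSet _

theorem prod_map_stairList {R A : Type*} [CommRing R] [Ring A] [Algebra R A] (e : ℕ → A)
    (x : ℕ → R) (n : ℕ) :
    ((stairList n).map fun p => 1 + x p.1 • e (p.1 + p.2)).prod =
      ((List.range n).map (stairRow e x n)).prod := by
  rw [stairList, List.map_flatMap, List.flatMap_def, List.prod_flatten, List.map_map]
  congr 1
  refine List.map_congr_left fun r _ => ?_
  rw [Function.comp_apply, stairRow, descProd, List.map_map]
  congr 1
  refine List.map_congr_left fun l hl => ?_
  simp only [List.mem_reverse, List.mem_range'_1] at hl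
  simp [linFactor, Nat.add_sub_of_le hl.1]

/-- The `β`-Grothendieck polynomials are the coefficients of the staircase product of
`0`-Hecke operators applied to the identity. -/
theorem prod_stairRow_apply {R : Type*} [CommRing R] (φ : BetaPoly →+* R) {n : ℕ} {v : SInf}
    (hv : FixesFrom n v) :
    ((List.range n).map (stairRow (heckeGen (φ beta)) (fun i => φ (X i)) n)).prod
      (Finsupp.single 1 1) v = φ (grothendieck v) := by
  classical
  rw [← prod_map_stairList, prod_map_one_add_smul (fun p : ℕ × ℕ => φ (X p.1))
    (fun p : ℕ × ℕ => heckeGen (φ beta) (p.1 + p.2)) (nodup_stairList n), grothendieck,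
    hv.pipeDreams_eq, finsum_mem_coe_finset, map_sum, Finset.sum_filter, LinearMap.sum_apply,
    Finsupp.finsetSum_apply]
  refine Finset.sum_congr rfl fun P hP => ?_
  have hword := word_eq_map_filter (Finset.mem_powerset.mp hP)
  have hmap : ((stairList n).filter (· ∈ P)).map (fun p => heckeGen (φ beta) (p.1 + p.2)) =
      (word P).map (heckeGen (φ beta)) := by
    rw [hword, List.map_map]
    rfl
  rw [hmap, LinearMap.smul_apply, heckeWord_single, Finsupp.smul_apply, Finsupp.single_apply,
    length_word, permLength_one, add_zero, mul_one]
  change _ • (if demazure (word P) = v then _ else _) = _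
  split_ifs with h
  · subst h
    rw [weight, map_mul, map_pow, map_prod, smul_eq_mul, mul_comm]
    rfl
  · rw [smul_zero]

/-! ### The Pieri rule -/

/-- The pairs `(v, a)` with `∂(a) * v = u`, where `a` is read increasingly. -/
def factorizations (u : SInf) : Set (SInf × Finset ℕ) := {p | demazureMul p.2.sort p.1 = u}

theorem FixesFrom.factorizations_subset {n : ℕ} {u : SInf} (hu : FixesFrom n u) :
    factorizations u ⊆ {v | FixesFrom n v} ×ˢ {a | a ⊆ Finset.range n} := by
  rintro ⟨v, a⟩ h
  have h : demazureMul a.sort v = u := h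
  refine ⟨FixesFrom.of_demazureMul (h ▸ hu), fun i hi => ?_⟩
  exact Finset.mem_range.mpr (FixesFrom.letter_lt (h ▸ hu) ((Finset.mem_sort _).mpr hi))

theorem finite_factorizations (u : SInf) : (factorizations u).Finite := by
  obtain ⟨n, hn⟩ := exists_fixesFrom u
  refine ((finite_fixesFrom n).prod ?_).subset hn.factorizations_subset
  exact (Finset.finite_toSet (Finset.range n).powerset).subset fun a ha =>
    Finset.mem_coe.mpr (Finset.mem_powerset.mpr ha)

theorem sort_eq_filter_range {n : ℕ} {a : Finset ℕ} (ha : a ⊆ Finset.range n) :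
    a.sort = (List.range n).filter (· ∈ a) := by
  have hpair : ((List.range n).filter (· ∈ a)).Pairwise (· < ·) :=
    List.pairwise_lt_range.filter _
  have hset : a = ((List.range n).filter (· ∈ a)).toFinset := by
    ext i
    simp only [List.mem_toFinset, List.mem_filter, List.mem_range, decide_eq_true_eq]
    exact ⟨fun hi => ⟨Finset.mem_range.mp (ha hi), hi⟩, fun hi => hi.2⟩
  conv_lhs => rw [hset]
  rw [List.toFinset_sort _ (hpair.imp ne_of_lt)]
  exact hpair.imp le_of_lt

theorem ascProd_eq_sum {R A : Type*} [CommRing R] [Ring A] [Algebra R A] (e : ℕ → A) (y : R)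
    (n : ℕ) : ascProd e y 0 n =
      ∑ a ∈ (Finset.range n).powerset, y ^ a.card • (a.sort.map e).prod := by
  have h := prod_map_one_add_smul (fun _ : ℕ => y) e (List.nodup_range (n := n))
  rw [ascProd, ← List.range_eq_range']
  refine h.trans ?_
  rw [List.toFinset_range]
  refine Finset.sum_congr rfl fun a ha => ?_
  rw [Finset.prod_const, sort_eq_filter_range (Finset.mem_powerset.mp ha)]

/-- The coefficient of `u` in the staircase product multiplied by an increasing product. -/
theorem ascProd_mul_stair_apply {R : Type*} [CommRing R] (φ : BetaPoly →+* R) (y : R) {n : ℕ}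
    {u : SInf} (hu : FixesFrom n u) :
    (ascProd (heckeGen (φ beta)) y 0 n *
      ((List.range n).map (stairRow (heckeGen (φ beta)) (fun i => φ (X i)) n)).prod)
        (Finsupp.single 1 1) u =
      ∑ p ∈ (finite_factorizations u).toFinset, y ^ p.2.card *
        φ (beta ^ (p.2.card + permLength p.1 - permLength u) * grothendieck p.1) := by
  classical
  set F := ((List.range n).map (stairRow (heckeGen (φ beta)) (fun i => φ (X i)) n)).prod
    (Finsupp.single 1 1) with hF
  have hterm : ∀ a : Finset ℕ, (a.sort.map (heckeGen (φ beta))).prod F u =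
      ∑ v ∈ F.support, if demazureMul a.sort v = u then
        φ beta ^ (a.card + permLength v - permLength u) * F v else 0 := by
    intro a
    conv_lhs => rw [← Finsupp.sum_single F, Finsupp.sum, map_sum, Finsupp.finsetSum_apply]
    refine Finset.sum_congr rfl fun v _ => ?_
    rw [heckeWord_single, Finsupp.single_apply, Finset.length_sort]
    split_ifs with h
    · rw [h]
    · rfl
  rw [Module.End.mul_apply, ← hF, ascProd_eq_sum, LinearMap.sum_apply, Finsupp.finsetSum_apply]
  have hsum : ∀ a ∈ (Finset.range n).powerset,
      ((y ^ a.card • (a.sort.map (heckeGen (φ beta))).prod) F) u =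
        ∑ v ∈ F.support, if demazureMul a.sort v = u then
          y ^ a.card * (φ beta ^ (a.card + permLength v - permLength u) * F v) else 0 := by
    intro a _
    rw [LinearMap.smul_apply, Finsupp.smul_apply, hterm, smul_eq_mul, Finset.mul_sum]
    simp only [mul_ite, mul_zero]
  rw [Finset.sum_congr rfl hsum, Finset.sum_comm,
    ← Finset.sum_product', ← Finset.sum_filter]
  have hval : ∀ p ∈ (finite_factorizations u).toFinset, F p.1 = φ (grothendieck p.1) := by
    intro p hp
    exact prod_stairRow_apply φ (hu.factorizations_subset ((Set.Finite.mem_toFinset _).mp hp)).1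
  have hsub : (F.support ×ˢ (Finset.range n).powerset).filter
      (fun p => demazureMul p.2.sort p.1 = u) ⊆ (finite_factorizations u).toFinset := by
    intro p hp
    exact (Set.Finite.mem_toFinset _).mpr (Finset.mem_filter.mp hp).2
  rw [Finset.sum_subset hsub]
  · refine Finset.sum_congr rfl fun p hp => ?_
    rw [hval p hp, map_mul, map_pow]
  · intro p hp hnot
    have hp' := (Set.Finite.mem_toFinset _).mp hp
    have h0 : F p.1 = 0 := by
      by_contra hne
      exact hnot (Finset.mem_filter.mpr ⟨Finset.mem_product.mpr ⟨Finsupp.mem_support_iff.mpr hne,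
        Finset.mem_powerset.mpr (hu.factorizations_subset hp').2⟩, hp'⟩)
    rw [h0, mul_zero, mul_zero]

/-- The generating function of the deformed elementary symmetric polynomials: the product of the
`x_r ⊕ y = x_r + y + β x_r y`. -/
theorem prod_formalSum (m : ℕ) :
    ∏ r ∈ Finset.range m, (Polynomial.C (X r) + Polynomial.X +
        Polynomial.C beta * Polynomial.C (X r) * Polynomial.X : Polynomial BetaPoly) =
      ∑ j ∈ Finset.range (m + 1), Polynomial.C (betaElem m j) * Polynomial.X ^ (m - j) := by
  have h1 : ∀ r ∈ Finset.range m, (Polynomial.C (X r) + Polynomial.X +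
      Polynomial.C beta * Polynomial.C (X r) * Polynomial.X : Polynomial BetaPoly) =
      Polynomial.C (X r) * (1 + Polynomial.C beta * Polynomial.X) + Polynomial.X := by
    intro r _
    ring
  rw [Finset.prod_congr rfl h1, Finset.prod_add]
  simp only [betaElem, map_sum, Finset.sum_mul]
  rw [Finset.sum_comm]
  refine Finset.sum_congr rfl fun I hI => ?_
  have hIm : I.card ≤ m := by
    simpa using Finset.card_le_card (Finset.mem_powerset.mp hI)
  rw [Finset.prod_mul_distrib, Finset.prod_const, Finset.prod_const,
    Finset.card_sdiff_of_subset (Finset.mem_powerset.mp hI), Finset.card_range, add_pow,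
    Finset.mul_sum, Finset.sum_mul]
  -- Extend the binomial expansion by zero: there are no `j`-subsets of `I` for `j > |I|`.
  have hsub : Finset.range (I.card + 1) ⊆ Finset.range (m + 1) :=
    Finset.range_subset_range.mpr (by omega)
  rw [← Finset.sum_subset hsub]
  · refine Finset.sum_congr rfl fun j hj => ?_
    have hj' : j ≤ I.card := by simpa [Nat.lt_succ_iff] using hj
    rw [Finset.sum_const, Finset.card_powersetCard, one_pow, one_mul, mul_pow, map_mul, map_pow,
      map_prod, show m - j = (I.card - j) + (m - I.card) by omega, pow_add, nsmul_eq_mul]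
    ring
  · intro j _ hj
    have hj' : I.card < j := by simpa using hj
    rw [Finset.powersetCard_eq_empty.mpr hj', Finset.sum_empty]

theorem notMem_descentFrom {m : ℕ} {w : SInf} (hw : ∀ i ∈ descents w, i < m) :
    w ∉ descentFrom m := by
  rintro ⟨i, hi, hm⟩
  exact absurd (hw i hi) (by omega)

/-- The Pieri rule with the generating function of the deformed elementary symmetric polynomials in
product form. -/
theorem prod_mul_grothendieck {R : Type*} [CommRing R] (φ : BetaPoly →+* R) (y : R) {m : ℕ}
    {w : SInf} (hw : ∀ i ∈ descents w, i < m) :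
    (∏ r ∈ Finset.range m, (φ (X r) + y + φ beta * φ (X r) * y)) * φ (grothendieck w) =
      ∑ p ∈ (finite_factorizations (ominus m w)).toFinset, y ^ p.2.card *
        φ (beta ^ (p.2.card + permLength p.1 - permLength (ominus m w)) * grothendieck p.1) := by
  obtain ⟨n₀, hn₀⟩ := exists_fixesFrom w
  obtain ⟨n, hn, hmn⟩ : ∃ n, FixesFrom n w ∧ m ≤ n :=
    ⟨max n₀ m, hn₀.mono (le_max_left _ _), le_max_right _ _⟩
  rw [← ascProd_mul_stair_apply φ y (hn.ominus hmn), (heckeRelations (φ beta)).ascProd_mul_stair,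
    prod_markedRow_apply_ominus _ hmn _ _ (notMem_descentFrom hw), prod_stairRow_apply φ hn]

/-- The Pieri rule in generating function form, as an identity of polynomials in `y`. -/
theorem sum_betaElem_mul_grothendieck {m : ℕ} {w : SInf} (hw : ∀ i ∈ descents w, i < m) :
    ∑ j ∈ Finset.range (m + 1),
        Polynomial.C (betaElem m j * grothendieck w) * Polynomial.X ^ (m - j) =
      ∑ p ∈ (finite_factorizations (ominus m w)).toFinset, Polynomial.C
        (beta ^ (p.2.card + permLength p.1 - permLength (ominus m w)) * grothendieck p.1) *
          Polynomial.X ^ p.2.card := by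
  have h1 := prod_mul_grothendieck (R := Polynomial BetaPoly) Polynomial.C Polynomial.X hw
  rw [prod_formalSum, Finset.sum_mul] at h1
  calc _ = _ := Finset.sum_congr rfl fun j _ => by rw [map_mul]; ring
    _ = _ := h1
    _ = _ := Finset.sum_congr rfl fun p _ => mul_comm _ _

theorem pieriIndex_subset (m k : ℕ) (w : SInf) :
    pieriIndex m k w ⊆ factorizations (ominus m w) := fun _ hp => hp.2.symm

theorem permLength_add_le_of_mem_pieriIndex {m k : ℕ} {w : SInf} {p : SInf × Finset ℕ}
    (hp : p ∈ pieriIndex m k w) : permLength w + k ≤ permLength p.1 := by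
  have h1 := permLength_demazureMul_le p.2.sort p.1
  rw [← hp.2, permLength_ominus, Finset.length_sort] at h1
  have := hp.1
  omega

end PipeDream

open PipeDream in
theorem proposition7p4 (m : ℕ) (hm : 1 ≤ m) (k : ℕ) (w : SInf)
    (hw : ∀ i ∈ descents w, i < m) :
    (∀ u : SInf, (pipeDreams u).Finite) ∧
    (pieriIndex m k w).Finite ∧
    (∀ p ∈ pieriIndex m k w, permLength w + k ≤ permLength p.1) ∧
    betaElem m k * grothendieck w =
      ∑ᶠ p ∈ pieriIndex m k w,
        beta ^ (permLength p.1 - permLength w - k) * grothendieck p.1 := by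
  classical
  refine ⟨finite_pipeDreams, (finite_factorizations _).subset (pieriIndex_subset m k w),
    fun p hp => permLength_add_le_of_mem_pieriIndex hp, ?_⟩
  rcases lt_or_ge m k with hk | hk
  · have hempty : pieriIndex m k w = ∅ := by
      refine Set.eq_empty_iff_forall_notMem.mpr fun p hp => ?_
      have := hp.1
      omega
    have hzero : betaElem m k = 0 := by
      refine Finset.sum_eq_zero fun I hI => ?_
      have : I.card ≤ m := by simpa using Finset.card_le_card (Finset.mem_powerset.mp hI)
      rw [Finset.powersetCard_eq_empty.mpr (by omega), Finset.sum_empty]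
    rw [hempty, hzero, finsum_mem_empty, zero_mul]
  -- Compare the coefficients of `y ^ (m - k)` in the generating function identity.
  have h := congrArg (fun q => Polynomial.coeff q (m - k)) (sum_betaElem_mul_grothendieck hw)
  simp only [Polynomial.finsetSum_coeff, Polynomial.coeff_C_mul_X_pow] at h
  rw [Finset.sum_eq_single k, if_pos rfl, ← Finset.sum_filter] at h
  · have hset : pieriIndex m k w = ↑((finite_factorizations (ominus m w)).toFinset.filter
        fun p => m - k = p.2.card) := by
      ext p
      simp only [Finset.coe_filter, Set.Finite.mem_toFinset, Set.mem_ofPred_eq]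
      constructor
      · intro hp
        have := hp.1
        exact ⟨pieriIndex_subset m k w hp, by omega⟩
      · rintro ⟨hp, hc⟩
        exact ⟨by omega, hp.symm⟩
    rw [h, hset, finsum_mem_coe_finset]
    refine Finset.sum_congr rfl fun p hp => ?_
    have hp' := (Finset.mem_filter.mp hp).2
    congr 2
    rw [permLength_ominus]
    omega
  · intro j hj hne
    rw [Finset.mem_range] at hj
    exact if_neg (by omega)
  · intro hk'
    exact absurd (Finset.mem_range.mpr (by omega)) hk'
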